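/- There is an absolute constant $C>0$ such that for every $n$ and every isotropic log-concave random vector $X$ in $\mathbb{R}^n$, $$\Gamma(X)\le C n^2 .$$ Here, writing $\mu$ for the distribution of $X$ and $B_2^n$ for the closed Euclidean unit ball, $$\Gamma(X)=\sup_{Q}\ \liminf_{\varepsilon\to 0^+}\frac{\mu\big((Q+\varepsilon B_2^n)\setminus Q\big)}{\varepsilon},$$ where the supremum runs over all convex sets $Q\subset\mathbb{R}^n$. The vector $X$ is called log-concave if $\mu(\lambda A+(1-\lambda)B)\ge \mu(A)^{\lambda}\mu(B)^{1-\lambda}$ for all nonempty Borel sets $A,B\subset\mathbb{R}^n$ and all $\lambda\in[0,1]$, and isotropic if $\mathbb{E}|X|^2<\infty$, $\mathbb{E}X=0$ and $\mathbb{E}\langle X,\theta\rangle^2=1$ for every unit vector $\theta\in\mathbb{R}^n$. -/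

import Mathlib

open MeasureTheory Filter Topology
open scoped Pointwise ENNReal

/-- A measure on `ℝⁿ` is log-concave if `μ(λA + (1-λ)B) ≥ μ(A)^λ μ(B)^(1-λ)` for all Borel sets
`A`, `B` and all `λ ∈ [0,1]`. The sets are taken nonempty: for `λ ∈ (0,1)` this excludes nothing
(the right-hand side is `0` if one of them is empty), and for `λ ∈ {0,1}` it avoids `0 ^ 0`. -/
def IsLogConcaveMeasure {n : ℕ} (μ : Measure (EuclideanSpace ℝ (Fin n))) : Prop :=
  ∀ A B : Set (EuclideanSpace ℝ (Fin n)), MeasurableSet A → MeasurableSet B →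
    A.Nonempty → B.Nonempty → ∀ l : ℝ, 0 ≤ l → l ≤ 1 →
      μ A ^ l * μ B ^ (1 - l) ≤ μ (l • A + (1 - l) • B)

/-- A measure on `ℝⁿ` is isotropic if it is a probability measure with finite second moments,
barycenter at the origin, and `∫ ⟨x, θ⟩² dμ(x) = 1` for every unit vector `θ`
(that is, with identity covariance matrix). -/
structure IsIsotropicMeasure {n : ℕ} (μ : Measure (EuclideanSpace ℝ (Fin n))) : Prop where
  isProbabilityMeasure : IsProbabilityMeasure μ
  memLp_two : MemLp (fun x => x) 2 μ
  barycenter_eq_zero : ∫ x, x ∂μ = 0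
  integral_inner_sq : ∀ θ : EuclideanSpace ℝ (Fin n), ‖θ‖ = 1 → ∫ x, (inner ℝ x θ) ^ 2 ∂μ = 1

/-- The perimeter `μ⁺(∂Q) = liminf_{ε → 0+} μ((Q + ε B₂ⁿ) \ Q) / ε`, with values in `[0, ∞]`. -/
noncomputable def outerPerimeter {n : ℕ} (μ : Measure (EuclideanSpace ℝ (Fin n)))
    (Q : Set (EuclideanSpace ℝ (Fin n))) : ℝ≥0∞ :=
  liminf (fun ε : ℝ =>
    μ ((Q + ε • Metric.closedBall (0 : EuclideanSpace ℝ (Fin n)) 1) \ Q) / ENNReal.ofReal ε)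
    (𝓝[>] 0)

/-- The maximal perimeter `Γ(μ)`: the supremum of `μ⁺(∂Q)` over all convex sets `Q` in `ℝⁿ`. -/
noncomputable def maxPerimeter {n : ℕ} (μ : Measure (EuclideanSpace ℝ (Fin n))) : ℝ≥0∞ :=
  ⨆ (Q : Set (EuclideanSpace ℝ (Fin n))) (_ : Convex ℝ Q), outerPerimeter μ Q

/-! Let `Q` be convex with interior `U`, where `U` is not the whole space and has positive mass. Let
`ν` be the law conditioned on `U` and `b` the barycenter of `ν`. Three estimates are combined.

Thin slabs: log-concavity and variance at least one in every direction force each slab of width `w`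
to have mass at most `60 w` (`LogConcave.slab_le`). Under `ν` a centered marginal bounded above by
`R` keeps mass `2/3` within `6 R` of zero. Taking the normal at the boundary point nearest to `b`
gives a ball of radius `r` about `b` inside `U`, with `μ(U) ≤ C r`
(`exists_closedBall_subset_of_slab_le`).

Half dilate: `ν` gives mass at least `exp (-H)` to `b + (U - b) / 2`, with `H` of order `n log n`,
here bounded by `C n²` (`LogConcave.le_half_dilate`). Most of the mass is cut into `exp H / 2` small
boxes adapted to the covariance. Concavity of the log-mass of a translated box, with an entropy
bound, shows that the box at the mean center is heavy. It lies in the half dilate, since one-sided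
bounds on `U` control standard deviations.

Growth: the `ε`-neighborhood of `U` lies in its dilate about `b` by `1 + ε / r`. Interpolating
between this dilate and the half dilate gives `μ(U_ε) ≤ μ(U) exp (2 ε H / r)`
(`LogConcave.measureReal_diff_le`). The perimeter is thus at most a constant times `H μ(U) / r`,
hence `C n²`. -/

section LogConcave

/-! ### Log-concave measures: restriction and conditioning -/

variable {E : Type*} [NormedAddCommGroup E] [InnerProductSpace ℝ E] [MeasurableSpace E]

/-- The log-concavity inequality for proper convex combinations of arbitrary Borel sets. -/
def LogConcave (μ : Measure E) : Prop :=
  ∀ A B : Set E, MeasurableSet A → MeasurableSet B → ∀ l : ℝ, 0 < l → l < 1 →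
    μ A ^ l * μ B ^ (1 - l) ≤ μ (l • A + (1 - l) • B)

theorem IsLogConcaveMeasure.logConcave {n : ℕ} {μ : Measure (EuclideanSpace ℝ (Fin n))}
    (h : IsLogConcaveMeasure μ) : LogConcave μ := by
  intro A B hA hB l h0 h1
  rcases A.eq_empty_or_nonempty with rfl | hAn
  · simp [ENNReal.zero_rpow_of_pos h0]
  rcases B.eq_empty_or_nonempty with rfl | hBn
  · simp [ENNReal.zero_rpow_of_pos (sub_pos.2 h1)]
  exact h A B hA hB hAn hBn l h0.le h1.le

theorem LogConcave.measureReal_le {μ : Measure E} [IsFiniteMeasure μ] (hμ : LogConcave μ)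
    {A B T : Set E} (hA : MeasurableSet A) (hB : MeasurableSet B) {l : ℝ} (h0 : 0 < l) (h1 : l < 1)
    (h : ∀ x ∈ A, ∀ y ∈ B, l • x + (1 - l) • y ∈ T) :
    μ.real A ^ l * μ.real B ^ (1 - l) ≤ μ.real T := by
  have hsub : l • A + (1 - l) • B ⊆ T := by
    rintro _ ⟨_, ⟨x, hx, rfl⟩, _, ⟨y, hy, rfl⟩, rfl⟩
    exact h x hx y hy
  have := (hμ A B hA hB l h0 h1).trans (measure_mono hsub)
  have h2 := ENNReal.toReal_mono (measure_ne_top μ T) this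
  rwa [ENNReal.toReal_mul, ← ENNReal.toReal_rpow, ← ENNReal.toReal_rpow] at h2

theorem LogConcave.restrict {μ : Measure E} (hμ : LogConcave μ) {U : Set E}
    (hU : MeasurableSet U) (hc : Convex ℝ U) : LogConcave (μ.restrict U) := by
  intro A B hA hB l h0 h1
  rw [Measure.restrict_apply hA, Measure.restrict_apply hB]
  refine (hμ _ _ (hA.inter hU) (hB.inter hU) l h0 h1).trans ?_
  refine le_trans (measure_mono ?_) (Measure.le_restrict_apply U _)
  rintro _ ⟨_, ⟨x, hx, rfl⟩, _, ⟨y, hy, rfl⟩, rfl⟩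
  exact ⟨⟨_, ⟨x, hx.1, rfl⟩, _, ⟨y, hy.1, rfl⟩, rfl⟩,
    hc hx.2 hy.2 h0.le (sub_pos.2 h1).le (by ring)⟩

theorem LogConcave.smul {μ : Measure E} (hμ : LogConcave μ) {c : ℝ≥0∞} (hc : c ≠ ∞)
    (hc0 : c ≠ 0) : LogConcave (c • μ) := by
  intro A B hA hB l h0 h1
  simp only [Measure.smul_apply, smul_eq_mul]
  rw [ENNReal.mul_rpow_of_nonneg _ _ h0.le, ENNReal.mul_rpow_of_nonneg _ _ (sub_pos.2 h1).le]
  calc c ^ l * μ A ^ l * (c ^ (1 - l) * μ B ^ (1 - l))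
      = (c ^ l * c ^ (1 - l)) * (μ A ^ l * μ B ^ (1 - l)) := by ring
    _ = c * (μ A ^ l * μ B ^ (1 - l)) := by
        rw [← ENNReal.rpow_add _ _ hc0 hc]; simp
    _ ≤ _ := by gcongr; exact hμ A B hA hB l h0 h1

theorem LogConcave.cond {μ : Measure E} [IsFiniteMeasure μ] (hμ : LogConcave μ) {U : Set E}
    (hU : MeasurableSet U) (hc : Convex ℝ U) (h0 : μ U ≠ 0) :
    LogConcave (ProbabilityTheory.cond μ U) :=
  (hμ.restrict hU hc).smul (ENNReal.inv_ne_top.2 h0) (ENNReal.inv_ne_zero.2 (measure_ne_top _ _))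

/-! ### One-dimensional marginals: tails, variance and slabs -/

variable [BorelSpace E]

theorem measurable_inner_left (θ : E) : Measurable (fun x : E => inner ℝ θ x) :=
  (innerSL ℝ θ).continuous.measurable

/-- Borell's lemma for a slab: geometric decay of the mass outside of its dilates. -/
theorem LogConcave.tail_le {ν : Measure E} [IsProbabilityMeasure ν] (hν : LogConcave ν)
    (θ : E) (a : ℝ) {ρ : ℝ}
    (h : 2 / 3 ≤ ν.real {x | |inner ℝ θ x - a| ≤ ρ}) (k : ℕ) :
    ν.real {x | (2 * k + 1) * ρ < |inner ℝ θ x - a|} ≤ 1 / 3 * (1 / 2) ^ k := by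
  have hm := measurable_inner_left θ
  have hA : MeasurableSet {x : E | |inner ℝ θ x - a| ≤ ρ} :=
    measurableSet_le (by fun_prop) measurable_const
  have hcompl : ν.real {x | ρ < |inner ℝ θ x - a|} ≤ 1 / 3 := by
    have : {x | ρ < |inner ℝ θ x - a|} = {x : E | |inner ℝ θ x - a| ≤ ρ}ᶜ := by
      ext x; simp
    rw [this, probReal_compl_eq_one_sub hA]; linarith
  rcases Nat.eq_zero_or_pos k with rfl | hk
  · simpa using hcompl
  have hk' : (1 : ℝ) ≤ k := by exact_mod_cast hk
  set S := {x : E | (2 * k + 1) * ρ < |inner ℝ θ x - a|} with hS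
  have hSm : MeasurableSet S := measurableSet_lt measurable_const (by fun_prop)
  -- This weight puts every mixture of a far point and a slab point outside the slab: `l (2k + 1) ρ
  -- - (1 - l) ρ = ρ`.
  set l : ℝ := 1 / (k + 1) with hl
  have h0 : 0 < l := by positivity
  have h1 : l < 1 := by rw [hl, div_lt_one (by positivity)]; linarith
  have hlk : l * (k + 1) = 1 := by rw [hl]; field_simp
  have key := hν.measureReal_le (T := {x | ρ < |inner ℝ θ x - a|}) hSm hA h0 h1 (by
    intro x hx y hy
    simp only [hS, Set.mem_ofPred_eq, inner_add_right, inner_smul_right] at hx hy ⊢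
    have e : l * inner ℝ θ x + (1 - l) * inner ℝ θ y - a
        = l * (inner ℝ θ x - a) + (1 - l) * (inner ℝ θ y - a) := by ring
    rw [e]
    have t1 : |l * (inner ℝ θ x - a)| = l * |inner ℝ θ x - a| := by
      rw [abs_mul, abs_of_pos h0]
    have t2 : |(1 - l) * (inner ℝ θ y - a)| = (1 - l) * |inner ℝ θ y - a| := by
      rw [abs_mul, abs_of_pos (sub_pos.2 h1)]
    have t3 := abs_sub_abs_le_abs_add (l * (inner ℝ θ x - a)) ((1 - l) * (inner ℝ θ y - a))
    have t4 : l * ((2 * k + 1) * ρ) < l * |inner ℝ θ x - a| := by gcongr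
    have t5 : (1 - l) * |inner ℝ θ y - a| ≤ (1 - l) * ρ :=
      mul_le_mul_of_nonneg_left hy (sub_pos.2 h1).le
    have t6 : l * ((2 * k + 1) * ρ) = 2 * ρ - l * ρ := by
      linear_combination 2 * ρ * hlk
    linarith)
  have hτ : 0 ≤ ν.real S := measureReal_nonneg
  have k1 : ν.real S ^ l * (2 / 3 : ℝ) ^ (1 - l) ≤ 1 / 3 := by
    refine le_trans ?_ (key.trans hcompl)
    gcongr
  have k2 : (ν.real S / (2 / 3)) ^ l ≤ 1 / 2 := by
    rw [Real.div_rpow hτ (by norm_num), div_le_iff₀ (by positivity)]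
    have e1 : (2 / 3 : ℝ) ^ (1 - l) = (2 / 3) / (2 / 3 : ℝ) ^ l := by
      rw [Real.rpow_sub (by norm_num), Real.rpow_one]
    rw [e1, ← mul_div_assoc, div_le_iff₀ (by positivity)] at k1
    linarith
  have k3 : ν.real S / (2 / 3) ≤ (1 / 2) ^ (k + 1) := by
    have := pow_le_pow_left₀ (by positivity) k2 (k + 1)
    rw [← Real.rpow_natCast, ← Real.rpow_mul (by positivity)] at this
    push_cast at this
    rwa [hlk, Real.rpow_one] at this
  rw [div_le_iff₀ (by norm_num)] at k3
  calc _ ≤ _ := k3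
    _ = _ := by ring

theorem sq_le_mul_three_halves_pow (k : ℕ) :
    (2 * (k : ℝ) + 3) ^ 2 ≤ 24 * (3 / 2) ^ k := by
  induction k with
  | zero => norm_num
  | succ k ih =>
    -- The ratio of consecutive squares is at most `3/2` only from `k = 3` on.
    rcases lt_or_ge k 3 with h | h
    · interval_cases k <;> norm_num
    · have h3 : (3 : ℝ) ≤ k := by exact_mod_cast h
      rw [pow_succ (3 / 2 : ℝ)]
      push_cast
      nlinarith

/-- Second moment bound for a log-concave measure giving mass `2/3` to a slab. -/
theorem LogConcave.integral_sq_le {ν : Measure E} [IsProbabilityMeasure ν] (hν : LogConcave ν)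
    (θ : E) (a : ℝ) {ρ : ℝ} (hρ : 0 < ρ)
    (h : 2 / 3 ≤ ν.real {x | |inner ℝ θ x - a| ≤ ρ}) :
    ∫ x, (inner ℝ θ x - a) ^ 2 ∂ν ≤ 33 * ρ ^ 2 := by
  have hm := measurable_inner_left θ
  set S : ℕ → Set E := fun k => {x : E | (2 * k + 1) * ρ < |inner ℝ θ x - a|} with hS
  have hSm : ∀ k, MeasurableSet (S k) := fun k => measurableSet_lt measurable_const (by fun_prop)
  rw [integral_eq_lintegral_of_nonneg_ae (ae_of_all _ fun x => sq_nonneg _)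
    (by fun_prop)]
  refine ENNReal.toReal_le_of_le_ofReal (by positivity) ?_
  -- On the shell between `S k` and `S (k + 1)` the square is at most `(2k + 3)² ρ²`. Against the
  -- tail decay this sums to at most `8 ρ² ∑ (3/4)^k = 32 ρ²`, and the core adds `ρ²`.
  have pw : ∀ x : E, ENNReal.ofReal ((inner ℝ θ x - a) ^ 2) ≤ ENNReal.ofReal (ρ ^ 2) +
      ∑' k : ℕ, (S k).indicator (fun _ => ENNReal.ofReal ((2 * k + 3) ^ 2 * ρ ^ 2)) x := by
    intro x
    set y := inner ℝ θ x - a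
    rcases le_or_gt |y| ρ with hy | hy
    · refine le_trans (ENNReal.ofReal_le_ofReal ?_) le_self_add
      exact sq_le_sq' (by linarith [neg_abs_le y]) ((le_abs_self y).trans hy)
    · refine le_trans ?_ le_add_self
      set t := (|y| / ρ - 1) / 2
      have hyt : |y| = (2 * t + 1) * ρ := by simp only [t]; field_simp; ring
      have ht : 0 < t := by
        have : 1 < |y| / ρ := (one_lt_div hρ).2 hy
        simp only [t]; linarith
      obtain ⟨k, hk1, hk2⟩ : ∃ k : ℕ, (k : ℝ) < t ∧ t ≤ k + 1 := by
        have hc : 0 < ⌈t⌉₊ := Nat.ceil_pos.2 ht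
        refine ⟨⌈t⌉₊ - 1, ?_, ?_⟩
        · exact Nat.lt_ceil.1 (by omega)
        · have := Nat.le_ceil t
          have h2 : ((⌈t⌉₊ - 1 : ℕ) : ℝ) + 1 = (⌈t⌉₊ : ℝ) := by
            exact_mod_cast Nat.sub_add_cancel hc
          linarith
      refine le_trans ?_ (ENNReal.le_tsum k)
      have hx : x ∈ S k := by
        change (2 * k + 1) * ρ < |y|
        rw [hyt]; gcongr
      rw [Set.indicator_of_mem hx]
      refine ENNReal.ofReal_le_ofReal ?_
      rw [← sq_abs y, ← mul_pow]
      refine pow_le_pow_left₀ (abs_nonneg _) ?_ 2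
      rw [hyt]
      exact mul_le_mul_of_nonneg_right (by linarith) hρ.le
  calc ∫⁻ x, ENNReal.ofReal ((inner ℝ θ x - a) ^ 2) ∂ν
      ≤ ∫⁻ x, (ENNReal.ofReal (ρ ^ 2) + ∑' k : ℕ, (S k).indicator
          (fun _ => ENNReal.ofReal ((2 * k + 3) ^ 2 * ρ ^ 2)) x) ∂ν := lintegral_mono pw
    _ = ENNReal.ofReal (ρ ^ 2) +
          ∑' k : ℕ, ENNReal.ofReal ((2 * k + 3) ^ 2 * ρ ^ 2) * ν (S k) := by
        rw [lintegral_add_left measurable_const, lintegral_tsum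
          (fun k => (measurable_const.indicator (hSm k)).aemeasurable)]
        simp [lintegral_indicator, hSm]
    _ ≤ ENNReal.ofReal (ρ ^ 2) + ∑' k : ℕ, ENNReal.ofReal (8 * ρ ^ 2 * (3 / 4) ^ k) := by
        gcongr with k
        rw [← ofReal_measureReal, ← ENNReal.ofReal_mul (by positivity)]
        refine ENNReal.ofReal_le_ofReal ?_
        calc (2 * (k : ℝ) + 3) ^ 2 * ρ ^ 2 * ν.real (S k)
            ≤ (24 * (3 / 2) ^ k) * ρ ^ 2 * (1 / 3 * (1 / 2) ^ k) := by
              gcongr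
              · exact sq_le_mul_three_halves_pow k
              · exact hν.tail_le θ a h k
          _ = 8 * ρ ^ 2 * ((3 / 2) ^ k * (1 / 2) ^ k) := by ring
          _ = _ := by rw [← mul_pow]; norm_num
    _ = ENNReal.ofReal (33 * ρ ^ 2) := by
        rw [← ENNReal.ofReal_tsum_of_nonneg (fun k => by positivity)
          ((summable_geometric_of_lt_one (by norm_num) (by norm_num)).mul_left _),
          tsum_mul_left, tsum_geometric_of_lt_one (by norm_num) (by norm_num),
          ← ENNReal.ofReal_add (by positivity) (by positivity)]
        congr 1; ring

/-- A centered one-dimensional marginal bounded above by `h` has most of its mass in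
`[-6h, 6h]`. -/
theorem two_thirds_le_of_le {Ω : Type*} [MeasurableSpace Ω] {ν : Measure Ω}
    [IsProbabilityMeasure ν] {Y : Ω → ℝ}
    (hYm : Measurable Y) (hY : Integrable Y ν) (hmean : ∫ x, Y x ∂ν = 0) {h : ℝ} (hh : 0 < h)
    (hle : ∀ᵐ x ∂ν, Y x ≤ h) : 2 / 3 ≤ ν.real {x | |Y x| ≤ 6 * h} := by
  -- Pointwise `|Y| ≤ 2 h - Y`, and `Y` has mean zero; Markov at level `6 h` then leaves `1/3`
  -- outside.
  have habs : ∫ x, |Y x| ∂ν ≤ 2 * h := by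
    have : ∫ x, |Y x| ∂ν ≤ ∫ x, (2 * h - Y x) ∂ν := by
      refine integral_mono_ae hY.abs ((integrable_const _).sub hY) ?_
      filter_upwards [hle] with x hx
      rcases abs_cases (Y x) with ⟨e, _⟩ | ⟨e, _⟩ <;> simp only [e] <;> linarith
    rwa [integral_sub (integrable_const _) hY, hmean, integral_const, probReal_univ, one_smul,
      sub_zero] at this
  have hmk := mul_meas_ge_le_integral_of_nonneg (ae_of_all _ fun x => abs_nonneg (Y x)) hY.abs
    (6 * h)
  have h3 : ν.real {x | 6 * h ≤ |Y x|} ≤ 1 / 3 := by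
    have : 6 * h * ν.real {x | 6 * h ≤ |Y x|} ≤ 6 * h * (1 / 3) := by linarith
    exact le_of_mul_le_mul_left this (by positivity)
  have hcompl : {x | |Y x| ≤ 6 * h}ᶜ ⊆ {x | 6 * h ≤ |Y x|} := by
    intro x hx; simp only [Set.mem_compl_iff, Set.mem_ofPred_eq, not_le] at hx ⊢; exact hx.le
  have h4 := (measureReal_mono (μ := ν) hcompl)
  rw [probReal_compl_eq_one_sub (measurableSet_le hYm.abs measurable_const)] at h4
  linarith

/-- Mass `1/6` beyond `a + 1/6` prevents the upper tail from dropping fast at `a`. Interpolating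
with weight `l = 12 w` reaches level `a + 2 w`, so the tail keeps at least the fraction `(1/6)^l ≥ 1
- 5 l`, and `5 l = 60 w`. -/
theorem LogConcave.slab_le_of_right {ν : Measure E} [IsProbabilityMeasure ν] (hν : LogConcave ν)
    (θ : E) (a : ℝ) {w : ℝ} (hw : 0 < w)
    (h : 1 / 6 ≤ ν.real {x | a + 1 / 6 ≤ inner ℝ θ x}) :
    ν.real {x | a ≤ inner ℝ θ x ∧ inner ℝ θ x ≤ a + w} ≤ 60 * w := by
  have hm := measurable_inner_left θ
  rcases le_or_gt (1 / 12) w with hw2 | hw2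
  · exact measureReal_le_one.trans (by linarith)
  set l := 12 * w
  have h0 : 0 < l := by positivity
  have h1 : l < 1 := by simp only [l]; linarith
  have hA : MeasurableSet {x : E | a + 1 / 6 ≤ inner ℝ θ x} := measurableSet_le measurable_const hm
  have hB : MeasurableSet {x : E | a ≤ inner ℝ θ x} := measurableSet_le measurable_const hm
  have hS : MeasurableSet {x : E | a + w < inner ℝ θ x} := measurableSet_lt measurable_const hm
  have key := hν.measureReal_le (T := {x | a + w < inner ℝ θ x}) hA hB h0 h1 (by
    intro x hx y hy
    simp only [Set.mem_ofPred_eq, inner_add_right, inner_smul_right] at hx hy ⊢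
    have t4 : l * (a + 1 / 6) ≤ l * inner ℝ θ x := by gcongr
    have t5 : (1 - l) * a ≤ (1 - l) * inner ℝ θ y :=
      mul_le_mul_of_nonneg_left hy (sub_pos.2 h1).le
    have : l * (1 / 6) = 2 * w := by simp only [l]; ring
    linarith)
  set ψ := ν.real {x : E | a ≤ inner ℝ θ x}
  have hψ0 : 0 ≤ ψ := measureReal_nonneg
  have hψ1 : ψ ≤ 1 := measureReal_le_one
  have hsum : ν.real {x | a ≤ inner ℝ θ x ∧ inner ℝ θ x ≤ a + w} +
      ν.real {x | a + w < inner ℝ θ x} ≤ ψ := by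
    rw [← measureReal_union _ hS]
    · refine measureReal_mono ?_
      rintro x (hx | hx)
      · exact hx.1
      · simp only [Set.mem_ofPred_eq] at hx ⊢; linarith
    · rw [Set.disjoint_left]
      intro x hx hx'
      simp only [Set.mem_ofPred_eq] at hx hx'
      linarith [hx.2]
  have k1 : (1 / 6 : ℝ) ^ l * ψ ≤ ν.real {x | a + w < inner ℝ θ x} := by
    refine le_trans ?_ key
    gcongr
    have := Real.rpow_le_rpow_of_exponent_ge_of_imp hψ0 hψ1 (sub_le_self 1 h0.le)
      (fun _ h => absurd h (by linarith))
    simpa using this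
  have k2 : 1 - 5 * l ≤ (1 / 6 : ℝ) ^ l := by
    rw [Real.rpow_def_of_pos (by norm_num)]
    have h6 : Real.log (1 / 6) ≥ -5 := by
      rw [one_div, Real.log_inv]
      have := Real.log_le_sub_one_of_pos (show (0 : ℝ) < 6 by norm_num)
      linarith
    have := Real.add_one_le_exp (Real.log (1 / 6) * l)
    nlinarith
  have : 5 * l = 60 * w := by simp only [l]; ring
  nlinarith

/-- Upper bound on the marginal density in a direction with variance at least one. -/
theorem LogConcave.slab_le {ν : Measure E} [IsProbabilityMeasure ν] (hν : LogConcave ν)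
    (θ : E) (hθ : ∀ a : ℝ, 1 ≤ ∫ x, (inner ℝ θ x - a) ^ 2 ∂ν) (a : ℝ) {w : ℝ} (hw : 0 < w) :
    ν.real {x | a ≤ inner ℝ θ x ∧ inner ℝ θ x ≤ a + w} ≤ 60 * w := by
  have hm := measurable_inner_left θ
  -- Otherwise the second moment about `a` would be at most `33/36 < 1`.
  have h1 : 1 / 3 < ν.real {x : E | |inner ℝ θ x - a| ≤ 1 / 6}ᶜ := by
    rw [probReal_compl_eq_one_sub (measurableSet_le (by fun_prop) measurable_const)]
    by_contra! hc
    have := hν.integral_sq_le θ a (ρ := 1 / 6) (by norm_num) (by linarith)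
    linarith [hθ a]
  have h2 : {x : E | |inner ℝ θ x - a| ≤ 1 / 6}ᶜ ⊆
      {x | a + 1 / 6 ≤ inner ℝ θ x} ∪ {x | inner ℝ θ x ≤ a - 1 / 6} := by
    intro x hx
    simp only [Set.mem_compl_iff, Set.mem_ofPred_eq, not_le, Set.mem_union] at hx ⊢
    rcases lt_abs.1 hx with h | h
    · left; linarith
    · right; linarith
  have h3 := (measureReal_mono (μ := ν) h2).trans (measureReal_union_le _ _)
  rcases le_or_gt (1 / 6) (ν.real {x | a + 1 / 6 ≤ inner ℝ θ x}) with h4 | h4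
  · exact hν.slab_le_of_right θ a hw h4
  -- Reflection maps the slab to one starting at `-(a + w)`, and the heavy left tail becomes a right
  -- tail.
  · have h5 := hν.slab_le_of_right (-θ) (-(a + w)) hw (by
      refine le_trans (by linarith) (measureReal_mono (μ := ν)
        (show {x | inner ℝ θ x ≤ a - 1 / 6} ⊆ _ from ?_))
      intro x hx
      simp only [Set.mem_ofPred_eq, inner_neg_left] at hx ⊢
      linarith)
    refine le_trans (measureReal_mono ?_) h5
    intro x hx
    simp only [Set.mem_ofPred_eq, inner_neg_left] at hx ⊢
    constructor <;> linarith [hx.1, hx.2]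

end LogConcave


/-! ### Boxes, entropy and discretization -/

section Cells

variable {E : Type*} [NormedAddCommGroup E] [InnerProductSpace ℝ E] [MeasurableSpace E]
  [BorelSpace E] {ι : Type*} [Fintype ι]

/-- The box of points whose coordinates `⟨v i, · - b⟩` are within `d i` of `c i`. -/
def coordBox (v : ι → E) (b : E) (d c : ι → ℝ) : Set E :=
  {z | ∀ i, |inner ℝ (v i) (z - b) - c i| ≤ d i}

theorem measurableSet_coordBox (v : ι → E) (b : E) (d c : ι → ℝ) :
    MeasurableSet (coordBox v b d c) := by
  have : coordBox v b d c = ⋂ i, {z | |inner ℝ (v i) (z - b) - c i| ≤ d i} := by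
    ext z; simp [coordBox]
  rw [this]
  refine MeasurableSet.iInter fun i => measurableSet_le ?_ measurable_const
  have h : Continuous fun z : E => |inner ℝ (v i) (z - b) - c i| := by fun_prop
  exact h.measurable

/-- With common half-widths `d`, convex combinations of points of two boxes stay in the box at the
combined center, by the triangle inequality in each coordinate. -/
theorem LogConcave.coordBox_le {ν : Measure E} [IsFiniteMeasure ν] (hν : LogConcave ν)
    (v : ι → E) (b : E) (d c c' : ι → ℝ) {l : ℝ} (h0 : 0 < l) (h1 : l < 1) :
    ν.real (coordBox v b d c) ^ l * ν.real (coordBox v b d c') ^ (1 - l) ≤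
      ν.real (coordBox v b d (l • c + (1 - l) • c')) := by
  refine hν.measureReal_le (measurableSet_coordBox v b d c) (measurableSet_coordBox v b d c')
    h0 h1 fun x hx y hy i => ?_
  have e : inner ℝ (v i) (l • x + (1 - l) • y - b) - (l • c + (1 - l) • c') i =
      l * (inner ℝ (v i) (x - b) - c i) + (1 - l) * (inner ℝ (v i) (y - b) - c' i) := by
    have : l • x + (1 - l) • y - b = l • (x - b) + (1 - l) • (y - b) := by module
    rw [this, inner_add_right, inner_smul_right, inner_smul_right]
    simp only [Pi.add_apply, Pi.smul_apply, smul_eq_mul]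
    ring
  rw [e]
  refine (abs_add_le _ _).trans ?_
  rw [abs_mul, abs_mul, abs_of_pos h0, abs_of_pos (sub_pos.2 h1)]
  have t1 := mul_le_mul_of_nonneg_left (hx i) h0.le
  have t2 := mul_le_mul_of_nonneg_left (hy i) (sub_pos.2 h1).le
  linarith

theorem LogConcave.concaveOn_log_coordBox {ν : Measure E} [IsFiniteMeasure ν] (hν : LogConcave ν)
    (v : ι → E) (b : E) (d : ι → ℝ) :
    ConcaveOn ℝ {c | 0 < ν.real (coordBox v b d c)}
      (fun c => Real.log (ν.real (coordBox v b d c))) := by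
  have key : ∀ c c' : ι → ℝ, 0 < ν.real (coordBox v b d c) → 0 < ν.real (coordBox v b d c') →
      ∀ l m : ℝ, 0 < l → 0 < m → l + m = 1 →
      0 < ν.real (coordBox v b d (l • c + m • c')) ∧
      l * Real.log (ν.real (coordBox v b d c)) + m * Real.log (ν.real (coordBox v b d c')) ≤
        Real.log (ν.real (coordBox v b d (l • c + m • c'))) := by
    intro c c' hc hc' l m hl hm hlm
    obtain rfl : m = 1 - l := by linarith
    have h := hν.coordBox_le v b d c c' hl (by linarith)
    have hp : 0 < ν.real (coordBox v b d c) ^ l * ν.real (coordBox v b d c') ^ (1 - l) := by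
      positivity
    refine ⟨hp.trans_le h, ?_⟩
    have := Real.log_le_log hp h
    rwa [Real.log_mul (by positivity) (by positivity), Real.log_rpow hc, Real.log_rpow hc']
      at this
  refine ⟨convex_iff_forall_pos.2 fun c hc c' hc' l m hl hm hlm =>
    (key c c' hc hc' l m hl hm hlm).1, ?_⟩
  intro c hc c' hc' l m hl hm hlm
  rcases hl.eq_or_lt with rfl | hl
  · obtain rfl : m = 1 := by linarith
    simp
  rcases hm.eq_or_lt with rfl | hm
  · obtain rfl : l = 1 := by linarith
    simp
  exact (key c c' hc hc' l m hl hm hlm).2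

/-- Gibbs' inequality against the uniform distribution. -/
theorem neg_log_card_le_sum_mul_log {κ : Type*} (T : Finset κ) (q : κ → ℝ)
    (hq : ∀ k ∈ T, 0 < q k) (hsum : ∑ k ∈ T, q k = 1) {M : ℝ} (hM : 0 < M) (hTM : (T.card : ℝ) ≤ M) :
    -Real.log M ≤ ∑ k ∈ T, q k * Real.log (q k) := by
  have h : ∀ k ∈ T, q k * (-Real.log M) + (q k - 1 / M) ≤ q k * Real.log (q k) := by
    intro k hk
    have hqk := hq k hk
    have := Real.log_le_sub_one_of_pos (show 0 < 1 / (M * q k) by positivity)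
    rw [one_div, Real.log_inv, Real.log_mul hM.ne' hqk.ne'] at this
    have h2 := mul_le_mul_of_nonneg_left this hqk.le
    have h3 : q k * ((M * q k)⁻¹ - 1) = 1 / M - q k := by field_simp
    rw [h3] at h2
    linarith
  have := Finset.sum_le_sum h
  rw [Finset.sum_add_distrib, ← Finset.sum_mul, hsum, Finset.sum_sub_distrib, hsum,
    Finset.sum_const, nsmul_eq_mul] at this
  have h4 : (T.card : ℝ) * (1 / M) ≤ 1 := by
    rw [mul_one_div, div_le_one hM]; exact hTM
  linarith

/-- If a log-concave measure gives mass at least `1/2` to a set `G` that is cut into `M` cells,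
each contained in a translate of a box, then the translate of the box centered at the weighted mean
of the centers has measure at least `1 / (2M)`. -/
theorem LogConcave.le_coordBox_sum {ν : Measure E} [IsProbabilityMeasure ν] (hν : LogConcave ν)
    (v : ι → E) (b : E) (d : ι → ℝ) {κ : Type*} (T : Finset κ)
    (c : κ → ι → ℝ) (w : κ → ℝ) (hw0 : ∀ k ∈ T, 0 ≤ w k)
    (hwle : ∀ k ∈ T, w k ≤ ν.real (coordBox v b d (c k)))
    (hw : 1 / 2 ≤ ∑ k ∈ T, w k) {M : ℝ} (hM : 0 < M) (hTM : (T.card : ℝ) ≤ M) :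
    1 / (2 * M) ≤ ν.real (coordBox v b d (∑ k ∈ T, (w k / ∑ k ∈ T, w k) • c k)) := by
  classical
  set W := ∑ k ∈ T, w k with hW
  have hWpos : 0 < W := by linarith
  set q : κ → ℝ := fun k => w k / W with hq
  -- Weightless cells are dropped: the log-mass is concave only where the mass is positive.
  set T' := T.filter fun k => w k ≠ 0
  have hwpos : ∀ k ∈ T', 0 < w k := fun k hk =>
    (hw0 k (Finset.mem_filter.1 hk).1).lt_of_ne (Finset.mem_filter.1 hk).2.symm
  have hqpos : ∀ k ∈ T', 0 < q k := fun k hk => div_pos (hwpos k hk) hWpos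
  have hqsum : ∑ k ∈ T', q k = 1 := by
    rw [← Finset.sum_div, Finset.sum_filter_ne_zero, ← hW, div_self hWpos.ne']
  have hcsum : ∑ k ∈ T', q k • c k = ∑ k ∈ T, q k • c k := by
    refine Finset.sum_subset (Finset.filter_subset _ _) fun k hk hk' => ?_
    have : w k = 0 := by simpa [T', hk] using hk'
    simp [q, this]
  have hle' : ∀ k ∈ T', w k ≤ ν.real (coordBox v b d (c k)) := fun k hk =>
    hwle k (Finset.mem_filter.1 hk).1
  have hconc := hν.concaveOn_log_coordBox v b d
  have hmem : ∀ k ∈ T', c k ∈ {c | 0 < ν.real (coordBox v b d c)} := fun k hk =>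
    (hwpos k hk).trans_le (hle' k hk)
  have hpos := hconc.1.sum_mem (fun k hk => (hqpos k hk).le) hqsum hmem
  -- Jensen bounds the log-mass at the mean center below by the `q`-average of log-masses. Each is
  -- at least `log (q k) + log W`, so the cost is the entropy of `q`, at most `log M`.
  have hJ := hconc.le_map_sum (fun k hk => (hqpos k hk).le) hqsum hmem
  rw [hcsum] at hJ hpos
  have hent := neg_log_card_le_sum_mul_log T' q hqpos hqsum hM
    ((Nat.cast_le.2 (Finset.card_le_card (Finset.filter_subset _ _))).trans hTM)
  have h1 : ∑ k ∈ T', q k * Real.log (q k) + Real.log W ≤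
      ∑ k ∈ T', q k • Real.log (ν.real (coordBox v b d (c k))) := by
    have : Real.log W = ∑ k ∈ T', q k * Real.log W := by rw [← Finset.sum_mul, hqsum, one_mul]
    rw [this, ← Finset.sum_add_distrib]
    refine Finset.sum_le_sum fun k hk => ?_
    rw [← mul_add, ← Real.log_mul (hqpos k hk).ne' hWpos.ne', smul_eq_mul]
    have e : q k * W = w k := div_mul_cancel₀ _ hWpos.ne'
    rw [e]
    exact mul_le_mul_of_nonneg_left (Real.log_le_log (hwpos k hk) (hle' k hk)) (hqpos k hk).le
  have h2 : Real.log (1 / 2) ≤ Real.log W := Real.log_le_log (by norm_num) hw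
  have h3 : Real.log (1 / (2 * M)) = Real.log (1 / 2) - Real.log M := by
    rw [← Real.log_div (by norm_num) hM.ne']; congr 1; field_simp
  refine (Real.log_le_log_iff (by positivity) hpos).1 ?_
  rw [h3]
  linarith

/-- Discretization at scale `d` of the coordinates `⟨v i, · - b⟩` on a set `G` on which they are
at most `N d`: a box with half-widths `d` centered near the mean over `G` has large measure. -/
theorem LogConcave.exists_coordBox {ν : Measure E} [IsProbabilityMeasure ν] (hν : LogConcave ν)
    (v : ι → E) (b : E) (d : ι → ℝ) (hd : ∀ i, 0 ≤ d i) (N : ℕ) {G : Set E}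
    (hG : MeasurableSet G) (hνG : 1 / 2 ≤ ν.real G)
    (hGd : ∀ x ∈ G, ∀ i, |inner ℝ (v i) (x - b)| ≤ N * d i)
    (hint : Integrable (fun x : E => x) ν) :
    ∃ c : ι → ℝ,
      1 / (2 * (2 * N + 1 : ℝ) ^ Fintype.card ι) ≤ ν.real (coordBox v b d c) ∧
      ∀ a : ι → ℝ, |ν.real G * ∑ i, a i * c i - ∫ x in G, ∑ i, a i * inner ℝ (v i) (x - b) ∂ν| ≤
        ν.real G * ∑ i, |a i| * d i := by
  classical
  -- Coordinates are rounded down to the grid `d i ℤ`. If `d i = 0`, division by zero gives index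
  -- `0`, which is correct since the coordinate then vanishes on `G`.
  set κ : E → ι → ℤ := fun x i => ⌊inner ℝ (v i) (x - b) / d i⌋ with hκ
  set T : Finset (ι → ℤ) := Fintype.piFinset fun _ => Finset.Icc (-(N : ℤ)) N
  have hκm : Measurable κ := by
    refine measurable_pi_lambda _ fun i => Int.measurable_floor.comp ?_
    have h : Continuous fun z : E => inner ℝ (v i) (z - b) / d i := by fun_prop
    exact h.measurable
  have hcell : ∀ x ∈ G, ∀ i, |inner ℝ (v i) (x - b) - κ x i * d i| ≤ d i := by
    intro x hx i
    have h := hGd x hx i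
    rcases (hd i).eq_or_lt with h0 | h0
    · rw [← h0] at h ⊢; simpa using h
    · have h1 := Int.floor_le (inner ℝ (v i) (x - b) / d i)
      have h2 := Int.lt_floor_add_one (inner ℝ (v i) (x - b) / d i)
      rw [le_div_iff₀ h0] at h1
      rw [div_lt_iff₀ h0] at h2
      rw [abs_le]
      constructor <;> simp only [hκ] <;> linarith
  have hκT : ∀ x ∈ G, κ x ∈ T := by
    intro x hx
    refine Fintype.mem_piFinset.2 fun i => Finset.mem_Icc.2 ?_
    have h := hGd x hx i
    rcases (hd i).eq_or_lt with h0 | h0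
    · simp [hκ, ← h0]
    · have h3 : |inner ℝ (v i) (x - b) / d i| ≤ N := by
        rw [abs_div, abs_of_pos h0, div_le_iff₀ h0]; exact h
      obtain ⟨h4, h5⟩ := abs_le.1 h3
      refine ⟨Int.le_floor.2 (by push_cast; exact h4), ?_⟩
      have := (Int.floor_le _).trans h5
      exact_mod_cast this
  set F : (ι → ℤ) → Set E := fun k => G ∩ κ ⁻¹' {k}
  have hFm : ∀ k, MeasurableSet (F k) := fun k => hG.inter (hκm (measurableSet_singleton k))
  have hFdisj : Set.PairwiseDisjoint (T : Set (ι → ℤ)) F := by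
    intro k _ k' _ hkk'
    refine Set.disjoint_left.2 fun x hx hx' => hkk' ?_
    exact hx.2.symm.trans hx'.2
  have hFU : G = ⋃ k ∈ T, F k := by
    ext x
    simp only [Set.mem_iUnion]
    constructor
    · intro hx; exact ⟨κ x, hκT x hx, hx, rfl⟩
    · rintro ⟨k, _, hx, _⟩; exact hx
  have hsum : ∑ k ∈ T, ν.real (F k) = ν.real G := by
    conv_rhs => rw [hFU]
    rw [measureReal_biUnion_finset hFdisj fun k _ => hFm k]
  have hGpos : 0 < ν.real G := by linarith
  have hTcard : (T.card : ℝ) = (2 * N + 1 : ℝ) ^ Fintype.card ι := by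
    have : (Finset.Icc (-(N : ℤ)) N).card = 2 * N + 1 := by
      rw [Int.card_Icc]; omega
    simp [T, this]
  have hbox := hν.le_coordBox_sum v b d T (fun k i => (k i : ℝ) * d i) (fun k => ν.real (F k))
    (fun k _ => measureReal_nonneg) (fun k _ => measureReal_mono (by
      rintro x ⟨hx, hxk⟩ i
      have := hcell x hx i
      rw [Set.mem_preimage, Set.mem_singleton_iff] at hxk
      rwa [hxk] at this)) (by rw [hsum]; exact hνG)
    (M := (2 * N + 1 : ℝ) ^ Fintype.card ι) (by positivity) hTcard.le
  refine ⟨_, hbox, fun a => ?_⟩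
  have hIn : ∀ i, Integrable (fun x : E => inner ℝ (v i) (x - b)) ν := fun i =>
    (hint.sub (integrable_const b)).const_inner (v i)
  have hI1 : IntegrableOn (fun x : E => ∑ i, a i * inner ℝ (v i) (x - b)) G ν :=
    (integrable_finsetSum _ fun i _ => (hIn i).const_mul _).integrableOn
  have hI2 : ∀ k, IntegrableOn (fun x : E => ∑ i, a i * (k i * d i : ℝ)) (F k) ν :=
    fun k => integrableOn_const
  have e1 : ν.real G * ∑ i, a i * (∑ k ∈ T, (ν.real (F k) / ∑ k ∈ T, ν.real (F k)) •
      (fun i => (k i : ℝ) * d i)) i = ∑ k ∈ T, ∫ x in F k, ∑ i, a i * (k i * d i : ℝ) ∂ν := by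
    rw [hsum]
    simp only [Finset.sum_apply, Pi.smul_apply, smul_eq_mul, setIntegral_const, Finset.mul_sum]
    rw [Finset.sum_comm]
    refine Finset.sum_congr rfl fun k _ => Finset.sum_congr rfl fun i _ => ?_
    field_simp
  have e2 : ∫ x in G, ∑ i, a i * inner ℝ (v i) (x - b) ∂ν =
      ∑ k ∈ T, ∫ x in F k, ∑ i, a i * inner ℝ (v i) (x - b) ∂ν := by
    conv_lhs => rw [hFU]
    exact integral_biUnion_finset T (fun k _ => hFm k) hFdisj
      fun k _ => hI1.mono_set Set.inter_subset_left
  rw [e1, e2, ← Finset.sum_sub_distrib, ← hsum, Finset.sum_mul]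
  refine (Finset.abs_sum_le_sum_abs _ _).trans (Finset.sum_le_sum fun k _ => ?_)
  rw [← integral_sub (hI2 k) (hI1.mono_set Set.inter_subset_left), mul_comm, ← Real.norm_eq_abs]
  refine norm_setIntegral_le_of_norm_le_const (measure_lt_top _ _) fun x hx => ?_
  rw [Real.norm_eq_abs, ← Finset.sum_sub_distrib]
  refine (Finset.abs_sum_le_sum_abs _ _).trans (Finset.sum_le_sum fun i _ => ?_)
  rw [← mul_sub, abs_mul, abs_sub_comm]
  have := hcell x hx.1 i
  rw [show κ x = k from hx.2] at this
  gcongr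

end Cells


/-! ### Chebyshev and Cauchy–Schwarz -/

section SecondMoment

variable {Ω : Type*} [MeasurableSpace Ω] {ν : Measure Ω} [IsProbabilityMeasure ν] {Y : Ω → ℝ}

/-- The strict inequality keeps Chebyshev valid for `s = 0`, so degenerate covariances need no
separate treatment. -/
theorem measureReal_mul_lt_abs_le (hY : MemLp Y 2 ν) {s R : ℝ}
    (hs : 0 ≤ s) (hs2 : ∫ x, Y x ^ 2 ∂ν = s ^ 2) (hR : 0 < R) :
    ν.real {x | R * s < |Y x|} ≤ 1 / R ^ 2 := by
  rcases hs.eq_or_lt with rfl | hs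
  · have h0 : (fun x => Y x ^ 2) =ᵐ[ν] 0 :=
      (integral_eq_zero_iff_of_nonneg (fun x => sq_nonneg _) hY.integrable_sq).1 (by
        rw [hs2]; simp)
    have : ν {x | R * 0 < |Y x|} = 0 := by
      rw [← nonpos_iff_eq_zero]
      refine (measure_mono ?_).trans (le_of_eq (ae_iff.1 h0))
      intro x hx
      simp only [mul_zero, Set.mem_ofPred_eq, abs_pos] at hx
      simpa using hx
    rw [measureReal_def, this]
    simp only [ENNReal.toReal_zero]
    positivity
  · have hmk := mul_meas_ge_le_integral_of_nonneg (ae_of_all _ fun x => sq_nonneg (Y x))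
      hY.integrable_sq ((R * s) ^ 2)
    rw [hs2] at hmk
    have hsub : {x | R * s < |Y x|} ⊆ {x | (R * s) ^ 2 ≤ Y x ^ 2} := by
      intro x hx
      simp only [Set.mem_ofPred_eq] at hx ⊢
      rw [← sq_abs (Y x)]
      exact pow_le_pow_left₀ (by positivity) hx.le 2
    refine (measureReal_mono hsub).trans ?_
    rw [le_div_iff₀ (by positivity)]
    have : s ^ 2 * (ν.real {x | (R * s) ^ 2 ≤ Y x ^ 2} * R ^ 2) ≤ s ^ 2 * 1 := by
      linarith
    exact le_of_mul_le_mul_left this (by positivity)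

theorem sq_setIntegral_le (hY : MemLp Y 2 ν) (A : Set Ω) :
    (∫ x in A, Y x ∂ν) ^ 2 ≤ ν.real A * ∫ x, Y x ^ 2 ∂ν := by
  set m := ∫ x in A, Y x ∂ν
  have hI : ∫ x in A, Y x ^ 2 ∂ν ≤ ∫ x, Y x ^ 2 ∂ν :=
    setIntegral_le_integral hY.integrable_sq (ae_of_all _ fun x => sq_nonneg _)
  have hYi : IntegrableOn Y A ν := (hY.integrable (by norm_num)).integrableOn
  have hY2 : IntegrableOn (fun x => Y x ^ 2) A ν := hY.integrable_sq.integrableOn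
  rcases (measureReal_nonneg (μ := ν) (s := A)).eq_or_lt with h0 | h0
  · have : ν A = 0 := by
      rw [measureReal_def] at h0
      exact ((ENNReal.toReal_eq_zero_iff _).1 h0.symm).resolve_right (measure_ne_top _ _)
    have hm : m = 0 := setIntegral_measure_zero _ this
    rw [hm, ← h0]; simp
  · set p := ν.real A
    -- Cauchy–Schwarz, from nonnegativity of the second moment about the average `m / p` over `A`.
    have hnn : 0 ≤ ∫ x in A, (Y x - m / p) ^ 2 ∂ν := integral_nonneg fun x => sq_nonneg _
    have e : ∫ x in A, (Y x - m / p) ^ 2 ∂ν =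
        ∫ x in A, Y x ^ 2 ∂ν - 2 * (m / p) * m + p * (m / p) ^ 2 := by
      have : ∀ x, (Y x - m / p) ^ 2 = Y x ^ 2 - 2 * (m / p) * Y x + (m / p) ^ 2 := fun x => by ring
      simp only [this]
      rw [integral_add (show IntegrableOn (fun x => Y x ^ 2 - 2 * (m / p) * Y x) A ν from
          hY2.sub (hYi.const_mul _)) (by exact integrableOn_const),
        integral_sub hY2 (hYi.const_mul _), integral_const_mul, setIntegral_const, smul_eq_mul]
    rw [e] at hnn
    have e2 : - 2 * (m / p) * m + p * (m / p) ^ 2 = - (m ^ 2 / p) := by field_simp; ring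
    have : m ^ 2 / p ≤ ∫ x, Y x ^ 2 ∂ν := by linarith
    rwa [div_le_iff₀ h0, mul_comm] at this

end SecondMoment

/-! ### Mass of the half dilate about the barycenter -/

section HalfDilate

theorem memLp_inner_sub {E : Type*} [NormedAddCommGroup E] [InnerProductSpace ℝ E]
    [MeasurableSpace E] {ν : Measure E} [IsProbabilityMeasure ν] (hL2 : MemLp id 2 ν) (θ b : E) :
    MemLp (fun x : E => inner ℝ θ (x - b)) 2 ν :=
  (hL2.sub (memLp_const b)).const_inner θ

variable {E : Type*} [NormedAddCommGroup E] [InnerProductSpace ℝ E] [MeasurableSpace E]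
  [FiniteDimensional ℝ E] {ν : Measure E} [IsProbabilityMeasure ν]

theorem integral_inner_sub_mean (hL2 : MemLp id 2 ν) (θ : E) :
    ∫ x, inner ℝ θ (x - ∫ y, y ∂ν) ∂ν = 0 := by
  have hi : Integrable (fun x : E => x) ν := hL2.integrable (by norm_num)
  rw [integral_inner (show Integrable (fun x : E => x - ∫ y, y ∂ν) ν from
    hi.sub (integrable_const _)), integral_sub hi (integrable_const _)]
  simp

/-- An open convex set of full measure contains the mean. -/
theorem mean_mem_of_isOpen_convex (hL2 : MemLp id 2 ν) {U : Set E} (hU : ∀ᵐ x ∂ν, x ∈ U)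
    (hUo : IsOpen U) (hUc : Convex ℝ U) : ∫ y, y ∂ν ∈ U := by
  by_contra hb
  obtain ⟨f, hf⟩ := geometric_hahn_banach_open_point hUc hUo hb
  have hi : Integrable (fun x : E => x) ν := hL2.integrable (by norm_num)
  have hfi : Integrable (fun x : E => f x) ν := f.integrable_comp hi
  have h0 : ∫ x, (f (∫ y, y ∂ν) - f x) ∂ν = 0 := by
    rw [integral_sub (integrable_const _) hfi, f.integral_comp_comm hi]; simp
  rw [integral_eq_zero_iff_of_nonneg_ae (by
    filter_upwards [hU] with x hx; simpa using (hf x hx).le)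
    (show Integrable (fun x => f (∫ y, y ∂ν) - f x) ν from (integrable_const _).sub hfi)] at h0
  obtain ⟨x, hx, hxU⟩ := (h0.and hU).exists
  simp only [Pi.zero_apply] at hx
  linarith [hf x hxU]

variable [BorelSpace E]

theorem covarianceBilin_self_eq_integral (hL2 : MemLp id 2 ν) (θ : E) :
    ProbabilityTheory.covarianceBilin ν θ θ = ∫ x, (inner ℝ θ (x - ∫ y, y ∂ν)) ^ 2 ∂ν := by
  rw [ProbabilityTheory.covarianceBilin_apply hL2]
  simp [sq]

theorem two_thirds_le_inner_sub_mean (hL2 : MemLp id 2 ν) {U : Set E} (hU : ∀ᵐ x ∂ν, x ∈ U)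
    (θ : E) {h : ℝ} (hh : 0 < h) (hle : ∀ x ∈ U, inner ℝ θ (x - ∫ y, y ∂ν) ≤ h) :
    2 / 3 ≤ ν.real {x | |inner ℝ θ (x - ∫ y, y ∂ν)| ≤ 6 * h} := by
  have hc : Continuous fun x : E => inner ℝ θ (x - ∫ y, y ∂ν) := by fun_prop
  exact two_thirds_le_of_le hc.measurable ((memLp_inner_sub hL2 θ _).integrable (by norm_num))
    (integral_inner_sub_mean hL2 θ) hh (hU.mono hle)

/-- A one-sided bound `h` on a centered marginal gives mass `2/3` to the slab of half-width `6 h`,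
hence variance at most `33 · 36 h² ≤ (35 h)²`. -/
theorem LogConcave.covarianceBilin_self_le (hν : LogConcave ν) (hL2 : MemLp id 2 ν) {U : Set E}
    (hU : ∀ᵐ x ∂ν, x ∈ U) (θ : E) {h : ℝ} (hh : 0 < h)
    (hle : ∀ x ∈ U, inner ℝ θ (x - ∫ y, y ∂ν) ≤ h) :
    ProbabilityTheory.covarianceBilin ν θ θ ≤ (35 * h) ^ 2 := by
  have h1 := two_thirds_le_inner_sub_mean hL2 hU θ hh hle
  rw [covarianceBilin_self_eq_integral hL2]
  simp only [inner_sub_right] at h1 ⊢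
  have h2 := hν.integral_sq_le θ _ (show 0 < 6 * h by positivity) h1
  nlinarith

/-- Pigeonhole would give a heavy box somewhere; averaging the centers gives one near the
barycenter. Its extent in any direction is a small fraction of the standard deviation `σ`, while `U`
extends at least `σ / 35` from the mean. -/
theorem LogConcave.le_half_dilate (hν : LogConcave ν) (hL2 : MemLp id 2 ν) {U : Set E}
    (hU : ∀ᵐ x ∂ν, x ∈ U) (hUo : IsOpen U) (hUc : Convex ℝ U) {n : ℕ} (hn : 1 ≤ n)
    (hfr : Module.finrank ℝ E = n) :
    1 / (2 * (2 * (313600 * n ^ 2 : ℕ) + 1 : ℝ) ^ n) ≤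
      ν.real {z | (∫ y, y ∂ν) + (2 : ℝ) • (z - ∫ y, y ∂ν) ∈ U} := by
  have hn' : (1 : ℝ) ≤ n := by exact_mod_cast hn
  have hbU := mean_mem_of_isOpen_convex hL2 hU hUo hUc
  set b := ∫ y, y ∂ν with hb
  set B := ProbabilityTheory.covarianceBilin ν with hB
  -- Orthogonality for the covariance splits the variance of `∑ a i • v i` as `∑ a i² s i²`, so `|a
  -- i| s i ≤ σ` for each `i`, even in the degenerate case.
  obtain ⟨v, hv⟩ := LinearMap.BilinForm.exists_orthogonal_basis (B := B.toBilinForm)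
    ⟨ProbabilityTheory.covarianceBilin_comm⟩
  set s : Fin (Module.finrank ℝ E) → ℝ := fun i => √(B (v i) (v i))
  have hs0 : ∀ i, 0 ≤ s i := fun i => Real.sqrt_nonneg _
  have hs2 : ∀ i, s i ^ 2 = B (v i) (v i) := fun i =>
    Real.sq_sqrt (ProbabilityTheory.covarianceBilin_self_nonneg _)
  -- The factor `1 / n` makes the `n` rounding errors add up to at most `σ / 560`. With `N = 560²
  -- n²` the cutoff `N d i` is `560 n` standard deviations, so Chebyshev and a union bound lose at
  -- most `1 / 560²`.
  set d : Fin (Module.finrank ℝ E) → ℝ := fun i => s i / (560 * n)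
  have hd0 : ∀ i, 0 ≤ d i := fun i => div_nonneg (hs0 i) (by positivity)
  set N : ℕ := 313600 * n ^ 2
  have hNd : ∀ i, N * d i = (560 * n) * s i := by
    intro i; simp only [N, d]; push_cast; field_simp; ring
  set G := coordBox v b (fun i => N * d i) 0
  have hGm : MeasurableSet G := measurableSet_coordBox _ _ _ _
  have hGc : ν.real Gᶜ ≤ 1 / 560 ^ 2 := by
    have hsub : Gᶜ ⊆ ⋃ i, {x | (560 * n) * s i < |inner ℝ (v i) (x - b)|} := by
      intro x hx
      simp only [G, coordBox, Set.mem_compl_iff, Set.mem_ofPred_eq, not_forall, not_le,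
        Pi.zero_apply, sub_zero, hNd] at hx
      simpa using hx
    refine (measureReal_mono hsub).trans ((measureReal_iUnion_fintype_le _).trans ?_)
    refine (Finset.sum_le_sum fun i _ => measureReal_mul_lt_abs_le (memLp_inner_sub hL2 (v i) b)
      (hs0 i) (by rw [hs2, hB, covarianceBilin_self_eq_integral hL2])
      (show (0 : ℝ) < 560 * n by positivity)).trans ?_
    rw [Finset.sum_const, Finset.card_univ, Fintype.card_fin, hfr, nsmul_eq_mul,
      mul_one_div, div_le_div_iff₀ (by positivity) (by positivity)]
    nlinarith
  have hGhalf : 1 / 2 ≤ ν.real G := by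
    rw [probReal_compl_eq_one_sub hGm] at hGc
    norm_num at hGc ⊢
    linarith
  obtain ⟨c, hc, hcm⟩ := hν.exists_coordBox v b d hd0 N hGm hGhalf
    (fun x hx i => by simpa using hx i) (hL2.integrable (by norm_num))
  have hpow : (2 * (N : ℝ) + 1) ^ n = (2 * (N : ℝ) + 1) ^ Module.finrank ℝ E := by rw [hfr]
  rw [Fintype.card_fin, ← hpow] at hc
  refine hc.trans (measureReal_mono fun z hz => ?_)
  -- A point of the box outside the half dilate would have its double about `b` separated from `U`
  -- by a functional `θ`.
  by_contra hzU
  obtain ⟨f, hf⟩ := geometric_hahn_banach_open_point hUc hUo hzU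
  set θ := (InnerProductSpace.toDual ℝ E).symm f
  have hθ : ∀ x, f x = inner ℝ θ x := fun x => by simp [θ]
  set a := v.repr θ
  have hθa : ∑ i, a i • v i = θ := v.sum_repr θ
  have hinner : ∀ y, ∑ i, a i * inner ℝ (v i) y = inner ℝ θ y := by
    intro y
    conv_rhs => rw [← hθa]
    rw [sum_inner]
    simp [inner_smul_left]
  have hvar : B θ θ = ∑ i, a i ^ 2 * s i ^ 2 := by
    conv_lhs => rw [← hθa]
    simp only [map_sum, map_smul, sum_apply, smul_apply,
      smul_eq_mul, hs2]
    refine Finset.sum_congr rfl fun i _ => ?_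
    rw [Finset.sum_eq_single i]
    · ring
    · intro j _ hji
      have h0 : B (v j) (v i) = 0 := hv hji
      simp [h0]
    · simp
  have hBnn : 0 ≤ B θ θ := ProbabilityTheory.covarianceBilin_self_nonneg _
  set σ := √(B θ θ)
  have hσ0 : 0 ≤ σ := Real.sqrt_nonneg _
  have hσ2 : σ ^ 2 = B θ θ := Real.sq_sqrt hBnn
  have hasσ : ∀ i, |a i| * s i ≤ σ := by
    intro i
    refine Real.le_sqrt_of_sq_le ?_
    rw [hvar, mul_pow, sq_abs]
    exact Finset.single_le_sum (f := fun i => a i ^ 2 * s i ^ 2) (fun j _ => by positivity)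
      (Finset.mem_univ i)
  have had : ∑ i, |a i| * d i ≤ σ / 560 := by
    have : ∀ i ∈ Finset.univ, |a i| * d i ≤ σ / (560 * n) := by
      intro i _
      simp only [d]
      rw [← mul_div_assoc]
      exact div_le_div_of_nonneg_right (hasσ i) (by positivity)
    refine (Finset.sum_le_sum this).trans (le_of_eq ?_)
    rw [Finset.sum_const, Finset.card_univ, Fintype.card_fin, hfr, nsmul_eq_mul]
    field_simp
  -- The full mean vanishes, so the integral over `G` is minus that over the small set `Gᶜ`.
  have hmean : |∫ x in G, inner ℝ θ (x - b) ∂ν| ≤ σ / 560 := by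
    have hI := (memLp_inner_sub hL2 θ b).integrable (by norm_num)
    have h1 := integral_add_compl hGm hI
    rw [integral_inner_sub_mean hL2] at h1
    have h2 := sq_setIntegral_le (memLp_inner_sub hL2 θ b) Gᶜ
    rw [← covarianceBilin_self_eq_integral hL2, ← hB, ← hσ2] at h2
    rw [show ∫ x in G, inner ℝ θ (x - b) ∂ν = - ∫ x in Gᶜ, inner ℝ θ (x - b) ∂ν by linarith,
      abs_neg]
    refine abs_le_of_sq_le_sq (h2.trans ?_) (by positivity)
    have := mul_le_mul_of_nonneg_right hGc (sq_nonneg σ)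
    refine this.trans (le_of_eq ?_)
    ring
  -- Rounding contributes one `σ / 560`; the truncated mean contributes up to two, because of
  -- division by `ν(G) ≥ 1/2`.
  have hac : |∑ i, a i * c i| ≤ 3 * σ / 560 := by
    have h1 := hcm a
    simp only [hinner] at h1
    have h2 : ν.real G * ∑ i, |a i| * d i ≤ ν.real G * (σ / 560) :=
      mul_le_mul_of_nonneg_left had measureReal_nonneg
    have h3 : ν.real G * |∑ i, a i * c i| ≤ ν.real G * (σ / 560) + σ / 560 := by
      rw [← abs_of_nonneg (measureReal_nonneg (μ := ν) (s := G)), ← abs_mul,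
        abs_of_nonneg (measureReal_nonneg (μ := ν) (s := G))]
      have := abs_sub_abs_le_abs_sub (ν.real G * ∑ i, a i * c i) (∫ x in G, inner ℝ θ (x - b) ∂ν)
      linarith
    nlinarith [abs_nonneg (∑ i, a i * c i)]
  have hz2 : |inner ℝ θ (z - b) - ∑ i, a i * c i| ≤ σ / 560 := by
    rw [← hinner, ← Finset.sum_sub_distrib]
    refine (Finset.abs_sum_le_sum_abs _ _).trans (le_trans (Finset.sum_le_sum fun i _ => ?_) had)
    rw [← mul_sub, abs_mul]
    exact mul_le_mul_of_nonneg_left (hz i) (abs_nonneg _)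
  have hzle : inner ℝ θ (z - b) ≤ σ / 140 := by
    have h1 := (abs_le.1 hz2).2
    have h2 := (abs_le.1 hac).2
    linarith
  have hUle : ∀ x ∈ U, inner ℝ θ (x - b) < 2 * inner ℝ θ (z - b) := by
    intro x hx
    have := hf x hx
    rw [hθ, hθ, inner_add_right, inner_smul_right] at this
    rw [inner_sub_right]
    linarith
  have hpos : 0 < 2 * inner ℝ θ (z - b) := by simpa using hUle b hbU
  -- With `t = ⟨θ, z - b⟩ > 0` this yields `σ ≤ 70 t`, against `t ≤ σ / 140`.
  have hσle := hν.covarianceBilin_self_le hL2 hU θ hpos fun x hx => (hUle x hx).le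
  have : σ ≤ 35 * (2 * inner ℝ θ (z - b)) := Real.sqrt_le_iff.2 ⟨by positivity, hσle⟩
  linarith

end HalfDilate


/-! ### From the half dilate to the perimeter -/

section Perimeter

variable {E : Type*} [NormedAddCommGroup E] [InnerProductSpace ℝ E]

theorem exists_norm_sub_le_of_mem_add_smul {Q : Set E} {ε : ℝ} (hε : 0 < ε) {x : E}
    (hx : x ∈ Q + ε • Metric.closedBall (0 : E) 1) : ∃ q ∈ Q, ‖x - q‖ ≤ ε := by
  obtain ⟨q, hq, _, ⟨e, he, rfl⟩, rfl⟩ := hx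
  refine ⟨q, hq, ?_⟩
  rw [mem_closedBall_zero_iff] at he
  simp only [add_sub_cancel_left, norm_smul, Real.norm_eq_abs, abs_of_pos hε]
  nlinarith

theorem inner_le_add_of_norm_sub_le {θ x q : E} (hθ : ‖θ‖ = 1) {ε : ℝ} (h : ‖x - q‖ ≤ ε) :
    |inner ℝ θ x - inner ℝ θ q| ≤ ε := by
  rw [← inner_sub_right]
  refine (abs_real_inner_le_norm _ _).trans ?_
  rwa [hθ, one_mul]

/-- Small balls around two support points combine into a small ball around the combined point.
Convexity allows a null open convex set to be separated from the support. -/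
theorem LogConcave.convex_support [MeasurableSpace E] [BorelSpace E] {μ : Measure E}
    (hμ : LogConcave μ) :
    Convex ℝ μ.support := by
  refine convex_iff_forall_pos.2 fun x hx y hy l m hl hm hlm => ?_
  obtain rfl : m = 1 - l := by linarith
  rw [Measure.mem_support_iff_forall] at hx hy ⊢
  intro V hV
  obtain ⟨r, hr, hrV⟩ := Metric.mem_nhds_iff.1 hV
  have h1 := hx _ (Metric.ball_mem_nhds x hr)
  have h2 := hy _ (Metric.ball_mem_nhds y hr)
  have hsub : l • Metric.ball x r + (1 - l) • Metric.ball y r ⊆ V := by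
    refine Set.Subset.trans ?_ hrV
    rintro _ ⟨_, ⟨x', hx', rfl⟩, _, ⟨y', hy', rfl⟩, rfl⟩
    simp only [Metric.mem_ball, dist_eq_norm] at hx' hy' ⊢
    have e : l • x' + (1 - l) • y' - (l • x + (1 - l) • y) =
        l • (x' - x) + (1 - l) • (y' - y) := by module
    rw [e]
    refine (norm_add_le _ _).trans_lt ?_
    rw [norm_smul, norm_smul, Real.norm_eq_abs, Real.norm_eq_abs, abs_of_pos hl, abs_of_pos hm]
    nlinarith
  refine lt_of_lt_of_le ?_ ((hμ _ _ Metric.isOpen_ball.measurableSet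
    Metric.isOpen_ball.measurableSet l hl (by linarith)).trans (measure_mono hsub))
  exact ENNReal.mul_pos (by simp [ENNReal.rpow_eq_zero_iff, h1.ne', hl.not_gt])
    (by simp [ENNReal.rpow_eq_zero_iff, h2.ne', sub_nonneg.1 hm.le])

/-- Growth of the mass of a convex set under neighborhoods, from a lower bound on the mass of its
dilate by the factor `1/2`. -/
theorem LogConcave.measureReal_diff_le [MeasurableSpace E] [BorelSpace E] {μ : Measure E}
    [IsProbabilityMeasure μ]
    (hμ : LogConcave μ) {U : Set E} (hUo : IsOpen U) (hUc : Convex ℝ U) {b : E} {r : ℝ}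
    (hr : 0 < r) (hball : Metric.closedBall b r ⊆ U) {H : ℝ} (hH : 0 ≤ H) (hp : 0 < μ.real U)
    (hhalf : μ.real U * Real.exp (-H) ≤ μ.real {z | b + (2 : ℝ) • (z - b) ∈ U})
    {ε : ℝ} (hε : 0 < ε) (hεH : 2 * (ε / r) * H ≤ 1) {V : Set E}
    (hV : ∀ x ∈ V, ∃ u ∈ U, ‖x - u‖ ≤ ε) :
    μ.real (V \ U) ≤ 4 * H * μ.real U / r * ε := by
  set δ := ε / r with hδ
  have hδ0 : 0 < δ := div_pos hε hr
  set W : Set E := {x | b + (1 + δ)⁻¹ • (x - b) ∈ U}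
  have hWo : IsOpen W := hUo.preimage (by fun_prop)
  set A : Set E := {z | b + (2 : ℝ) • (z - b) ∈ U}
  have hAo : IsOpen A := hUo.preimage (by fun_prop)
  have hVW : V ⊆ W := by
    intro x hx
    obtain ⟨u, hu, hxu⟩ := hV x hx
    -- The displacement rescaled to length at most `r` stays in the inner ball; mixing it with `u`
    -- gives the contraction of `x` toward `b`.
    have hy : b + δ⁻¹ • (x - u) ∈ U := by
      refine hball ?_
      rw [Metric.mem_closedBall, dist_eq_norm, add_sub_cancel_left, norm_smul, norm_inv,
        Real.norm_eq_abs, abs_of_pos hδ0, inv_mul_le_iff₀ hδ0, hδ, div_mul_cancel₀ _ hr.ne']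
      exact hxu
    have := hUc hu hy (a := (1 + δ)⁻¹) (b := δ * (1 + δ)⁻¹) (by positivity) (by positivity)
      (by field_simp)
    change b + (1 + δ)⁻¹ • (x - b) ∈ U
    convert this using 1
    rw [smul_add, smul_smul, show δ * (1 + δ)⁻¹ * δ⁻¹ = (1 + δ)⁻¹ by field_simp]
    have e : δ * (1 + δ)⁻¹ = 1 - (1 + δ)⁻¹ := by field_simp; ring
    rw [e]
    module
  have hUW : U ⊆ W := by
    intro x hx
    have := hUc hx (hball (Metric.mem_closedBall_self hr.le)) (a := (1 + δ)⁻¹)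
      (b := 1 - (1 + δ)⁻¹) (by positivity) 
      (sub_nonneg.2 (inv_le_one_of_one_le₀ (by linarith))) (by ring)
    change b + (1 + δ)⁻¹ • (x - b) ∈ U
    convert this using 1
    module
  -- Chosen so that the dilation factors average to one: `l / 2 + (1 - l) (1 + δ) = 1`.
  set l := 2 * δ / (1 + 2 * δ) with hl
  have hl0 : 0 < l := by positivity
  have hl1 : l < 1 := by rw [hl, div_lt_one (by positivity)]; linarith
  have h1l : 1 - l = 1 / (1 + 2 * δ) := by rw [hl]; field_simp; ring
  have key := hμ.measureReal_le (T := U) hAo.measurableSet hWo.measurableSet hl0 hl1 (by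
    intro x hx y hy
    have := hUc hx hy (a := l / 2) (b := (1 - l) * (1 + δ)) (by positivity)
      (mul_nonneg (sub_nonneg.2 hl1.le) (by positivity)) (by rw [h1l, hl]; field_simp; ring)
    convert this using 1
    have e : b + (1 + δ)⁻¹ • (y - b) = (1 + δ)⁻¹ • ((1 + δ) • b + (y - b)) := by
      rw [smul_add, smul_smul, inv_mul_cancel₀ (by positivity), one_smul]
    rw [e, smul_smul, mul_assoc, mul_inv_cancel₀ (by positivity), mul_one]
    have e2 : (1 - l) * δ = l / 2 := by rw [h1l, hl]; field_simp
    have e3 : (1 - l) • ((1 + δ) • b + (y - b)) = ((1 - l) * δ) • b + (1 - l) • y := by module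
    rw [e3, e2]
    module)
  set p := μ.real U
  set F := μ.real W
  have hF0 : 0 ≤ F := measureReal_nonneg
  have hlog : F ≤ p * Real.exp (2 * δ * H) := by
    have k1 : (p * Real.exp (-H)) ^ l * F ^ (1 - l) ≤ p := by
      refine le_trans ?_ key
      gcongr
    -- The exponent `1 + 2 δ = 1 / (1 - l)` isolates `F`.
    have k2 := Real.rpow_le_rpow (by positivity) k1 (show 0 ≤ 1 + 2 * δ by positivity)
    rw [Real.mul_rpow (by positivity) (by positivity), ← Real.rpow_mul (by positivity),
      ← Real.rpow_mul hF0, h1l, one_div_mul_cancel (by positivity), Real.rpow_one, hl,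
      div_mul_cancel₀ _ (by positivity), Real.mul_rpow hp.le (by positivity), ← Real.exp_mul,
      Real.rpow_add hp, Real.rpow_one] at k2
    have k3 : 0 < p ^ (2 * δ) := by positivity
    have k4 : Real.exp (-H * (2 * δ)) * F ≤ p := by
      refine le_of_mul_le_mul_left ?_ k3
      linarith
    calc F = Real.exp (2 * δ * H) * (Real.exp (-H * (2 * δ)) * F) := by
            rw [← mul_assoc, ← Real.exp_add]
            rw [show 2 * δ * H + -H * (2 * δ) = 0 by ring, Real.exp_zero, one_mul]
      _ ≤ Real.exp (2 * δ * H) * p := by gcongr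
      _ = _ := mul_comm _ _
  have hexp : Real.exp (2 * δ * H) ≤ 1 + 4 * δ * H := by
    have h0 : 0 ≤ 2 * δ * H := by positivity
    have := Real.abs_exp_sub_one_le (x := 2 * δ * H) (by rwa [abs_of_nonneg h0])
    rw [abs_of_nonneg h0] at this
    linarith [le_abs_self (Real.exp (2 * δ * H) - 1)]
  calc μ.real (V \ U) ≤ μ.real (W \ U) := measureReal_mono (Set.sdiff_subset_sdiff_left hVW)
    _ = F - p := measureReal_sdiff hUW hUo.measurableSet
    _ ≤ p * (4 * δ * H) := by nlinarith
    _ = _ := by rw [hδ]; field_simp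

variable [FiniteDimensional ℝ E]

/-- A nonzero functional on a Euclidean space is a positive multiple of the inner product with a
unit vector. -/
theorem exists_unit_inner_eq {f : StrongDual ℝ E} (hf : f ≠ 0) :
    ∃ θ : E, ‖θ‖ = 1 ∧ ∃ c : ℝ, 0 < c ∧ ∀ x, f x = c * inner ℝ θ x := by
  set θ := (InnerProductSpace.toDual ℝ E).symm f
  have hθ : ∀ x, f x = inner ℝ θ x := fun x => by simp [θ]
  have h0 : θ ≠ 0 := by simpa [θ] using hf
  have h1 : 0 < ‖θ‖ := norm_pos_iff.2 h0
  refine ⟨‖θ‖⁻¹ • θ, by rw [norm_smul, norm_inv, norm_norm, inv_mul_cancel₀ h1.ne'], ‖θ‖, h1,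
    fun x => ?_⟩
  rw [hθ, inner_smul_left, conj_trivial, mul_inv_cancel_left₀ h1.ne']

/-- A convex set with empty interior lies in a hyperplane. -/
theorem exists_unit_inner_eq_of_interior_eq_empty {Q : Set E} (hQ : Convex ℝ Q)
    (hne : Q.Nonempty) (hint : interior Q = ∅) :
    ∃ θ : E, ‖θ‖ = 1 ∧ ∃ a : ℝ, ∀ q ∈ Q, inner ℝ θ q = a := by
  obtain ⟨q₀, hq₀⟩ := hne
  have hspan : affineSpan ℝ Q ≠ ⊤ := by
    rw [Ne, ← hQ.interior_nonempty_iff_affineSpan_eq_top, hint]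
    exact Set.not_nonempty_empty
  have hdir : (affineSpan ℝ Q).direction ≠ ⊤ := fun h => hspan
    ((AffineSubspace.direction_eq_top_iff_of_nonempty ⟨q₀, subset_affineSpan ℝ Q hq₀⟩).1 h)
  have hperp : (affineSpan ℝ Q).directionᗮ ≠ ⊥ := fun h =>
    hdir (Submodule.orthogonal_eq_bot_iff.1 h)
  obtain ⟨θ, hθ, hθ0⟩ := Submodule.exists_mem_ne_zero_of_ne_bot hperp
  have h1 : 0 < ‖θ‖ := norm_pos_iff.2 hθ0
  refine ⟨‖θ‖⁻¹ • θ, by rw [norm_smul, norm_inv, norm_norm, inv_mul_cancel₀ h1.ne'],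
    inner ℝ (‖θ‖⁻¹ • θ) q₀, fun q hq => ?_⟩
  have hmem : q - q₀ ∈ (affineSpan ℝ Q).direction :=
    AffineSubspace.vsub_mem_direction (subset_affineSpan ℝ Q hq) (subset_affineSpan ℝ Q hq₀)
  have := Submodule.inner_left_of_mem_orthogonal hmem hθ
  rw [inner_sub_right] at this
  rw [inner_smul_left, inner_smul_left, sub_eq_zero.1 this]

variable [MeasurableSpace E] [BorelSpace E]

theorem measureReal_cond_apply {Ω : Type*} [MeasurableSpace Ω] {μ : Measure Ω} {U : Set Ω}
    (hU : MeasurableSet U) (S : Set Ω) :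
    (ProbabilityTheory.cond μ U).real S = (μ.real U)⁻¹ * μ.real (U ∩ S) := by
  rw [measureReal_def, ProbabilityTheory.cond_apply hU, ENNReal.toReal_mul, ENNReal.toReal_inv]
  rfl

/-- Relation between the mass of an open convex set and its inradius about the barycenter. -/
theorem exists_closedBall_subset_of_slab_le {μ : Measure E} [IsProbabilityMeasure μ]
    (hL2 : MemLp id 2 μ) {D : ℝ}
    (hslab : ∀ θ : E, ‖θ‖ = 1 → ∀ a w : ℝ, 0 < w →
      μ.real {x | a ≤ inner ℝ θ x ∧ inner ℝ θ x ≤ a + w} ≤ D * w)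
    {U : Set E} (hUo : IsOpen U) (hUc : Convex ℝ U) (hUne : U ≠ Set.univ) (hU0 : μ U ≠ 0) :
    ∃ r : ℝ, 0 < r ∧ Metric.closedBall (∫ y, y ∂(ProbabilityTheory.cond μ U)) r ⊆ U ∧
      μ.real U ≤ 36 * D * r := by
  have : IsProbabilityMeasure (ProbabilityTheory.cond μ U) :=
    ProbabilityTheory.cond_isProbabilityMeasure hU0
  have hL2' : MemLp id 2 (ProbabilityTheory.cond μ U) :=
    (hL2.restrict U).smul_measure (ENNReal.inv_ne_top.2 hU0)
  have hUae : ∀ᵐ x ∂(ProbabilityTheory.cond μ U), x ∈ U :=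
    ProbabilityTheory.ae_cond_mem hUo.measurableSet
  have hbU := mean_mem_of_isOpen_convex hL2' hUae hUo hUc
  set b := ∫ y, y ∂(ProbabilityTheory.cond μ U) with hb
  have hcne : Uᶜ.Nonempty := Set.nonempty_compl.2 hUne
  obtain ⟨z, hzU, hz⟩ := hUo.isClosed_compl.exists_infDist_eq_dist hcne b
  set R := Metric.infDist b Uᶜ
  have hR : 0 < R := (hUo.isClosed_compl.notMem_iff_infDist_pos hcne).1 (by simpa using hbU)
  -- Half the distance to the complement keeps the closed ball inside the open set.
  refine ⟨R / 2, by positivity, ?_, ?_⟩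
  · intro x hx
    by_contra hxU
    have h1 : R ≤ dist b x := Metric.infDist_le_dist_of_mem hxU
    rw [Metric.mem_closedBall, dist_comm] at hx
    linarith
  -- The hyperplane through the nearest complement point `z` is at distance at most `R` from `b`.
  -- The slab of width `12 R` then carries two thirds of `μ(U)`, so `μ(U) ≤ 18 D R`.
  · obtain ⟨f, hf⟩ := geometric_hahn_banach_open_point hUc hUo hzU
    have hf0 : f ≠ 0 := by
      rintro rfl
      simpa using hf b hbU
    obtain ⟨θ, hθ, c, hc, hfθ⟩ := exists_unit_inner_eq hf0
    have hle : ∀ x ∈ U, inner ℝ θ (x - b) ≤ R := by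
      intro x hx
      have h1 := hf x hx
      rw [hfθ, hfθ] at h1
      have h2 := lt_of_mul_lt_mul_left h1 hc.le
      have h3 := (abs_le.1 (inner_le_add_of_norm_sub_le hθ (x := z) (q := b) le_rfl)).2
      rw [← dist_eq_norm, dist_comm, ← hz] at h3
      rw [inner_sub_right]
      linarith
    have h23 := two_thirds_le_inner_sub_mean hL2' hUae θ hR hle
    set S : Set E := {x | |inner ℝ θ (x - b)| ≤ 6 * R}
    have hcond : (ProbabilityTheory.cond μ U).real S ≤ (μ.real U)⁻¹ * μ.real S := by
      rw [measureReal_cond_apply hUo.measurableSet]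
      exact mul_le_mul_of_nonneg_left (measureReal_mono Set.inter_subset_right)
        (inv_nonneg.2 measureReal_nonneg)
    have hUpos : 0 < μ.real U := ENNReal.toReal_pos hU0 (measure_ne_top _ _)
    have h1 := h23.trans hcond
    rw [inv_mul_eq_div, le_div_iff₀ hUpos] at h1
    have h2 := hslab θ hθ (inner ℝ θ b - 6 * R) (12 * R) (by positivity)
    have h3 : μ.real S ≤ D * (12 * R) := by
      refine le_trans (measureReal_mono ?_) h2
      intro x hx
      have hx' : |inner ℝ θ (x - b)| ≤ 6 * R := hx
      obtain ⟨h4, h5⟩ := abs_le.1 hx'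
      rw [inner_sub_right] at h4 h5
      constructor <;> linarith
    linarith

theorem log_two_mul_pow_le {n : ℕ} (hn : 1 ≤ n) :
    Real.log (2 * (2 * (313600 * n ^ 2 : ℕ) + 1 : ℝ) ^ n) ≤ 627204 * (n : ℝ) ^ 2 := by
  have hn' : (1 : ℝ) ≤ n := by exact_mod_cast hn
  have h1 : Real.log (2 * (313600 * n ^ 2 : ℕ) + 1 : ℝ) ≤ 627203 * n := by
    calc Real.log (2 * (313600 * n ^ 2 : ℕ) + 1 : ℝ) ≤ Real.log (627201 * (n : ℝ) ^ 2) := by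
          refine Real.log_le_log (by positivity) ?_
          push_cast
          nlinarith
      _ = Real.log 627201 + 2 * Real.log n := by
          rw [Real.log_mul (by norm_num) (by positivity), Real.log_pow]; norm_num
      _ ≤ 627201 + 2 * n := by
          have := Real.log_le_self (show (0 : ℝ) ≤ 627201 by norm_num)
          have := Real.log_le_self (show (0 : ℝ) ≤ n by positivity)
          linarith
      _ ≤ _ := by linarith
  rw [Real.log_mul (by norm_num) (by positivity), Real.log_pow]
  have h2 : Real.log 2 ≤ 1 := by linarith [Real.log_two_lt_d9]
  have h3 := mul_le_mul_of_nonneg_left h1 (show (0 : ℝ) ≤ n by positivity)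
  nlinarith

/-- In the degenerate cases the added layer is empty or essentially in a slab of width `2 ε`.
Otherwise `H μ(U) / r` is bounded by the two geometric estimates. -/
theorem LogConcave.eventually_measureReal_diff_le {μ : Measure E} [IsProbabilityMeasure μ]
    (hμ : LogConcave μ) (hL2 : MemLp id 2 μ) {n : ℕ} (hn : 1 ≤ n)
    (hfr : Module.finrank ℝ E = n) {D : ℝ} (hD : 0 ≤ D)
    (hslab : ∀ θ : E, ‖θ‖ = 1 → ∀ a w : ℝ, 0 < w →
      μ.real {x | a ≤ inner ℝ θ x ∧ inner ℝ θ x ≤ a + w} ≤ D * w)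
    {Q : Set E} (hQ : Convex ℝ Q) :
    ∀ᶠ ε : ℝ in 𝓝[>] 0, μ.real ((Q + ε • Metric.closedBall (0 : E) 1) \ Q) ≤
      288 * 627204 * D * (n : ℝ) ^ 2 * ε := by
  have hn' : (1 : ℝ) ≤ (n : ℝ) ^ 2 := one_le_pow₀ (by exact_mod_cast hn)
  have hcoef : 288 * 627204 * D ≤ 288 * 627204 * D * (n : ℝ) ^ 2 :=
    le_mul_of_one_le_right (by positivity) hn'
  rcases Q.eq_empty_or_nonempty with rfl | hne
  · filter_upwards [self_mem_nhdsWithin] with ε hε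
    rw [Set.mem_Ioi] at hε
    simp only [Set.empty_add, Set.sdiff_self, measureReal_empty]
    positivity
  rcases (interior Q).eq_empty_or_nonempty with hint | hint
  · obtain ⟨θ, hθ, a, ha⟩ := exists_unit_inner_eq_of_interior_eq_empty hQ hne hint
    filter_upwards [self_mem_nhdsWithin] with ε hε
    rw [Set.mem_Ioi] at hε
    have h1 := hslab θ hθ (a - ε) (2 * ε) (by positivity)
    have h2 : μ.real ((Q + ε • Metric.closedBall (0 : E) 1) \ Q) ≤ D * (2 * ε) := by
      refine le_trans (measureReal_mono ?_) h1
      rintro x ⟨hx, _⟩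
      obtain ⟨q, hq, hxq⟩ := exists_norm_sub_le_of_mem_add_smul hε hx
      have := abs_le.1 (inner_le_add_of_norm_sub_le hθ hxq)
      rw [ha q hq] at this
      constructor <;> linarith [this.1, this.2]
    have h3 := mul_le_mul_of_nonneg_right hcoef hε.le
    nlinarith [mul_nonneg hD hε.le]
  set U := interior Q
  have hUo : IsOpen U := isOpen_interior
  have hUc : Convex ℝ U := hQ.interior
  -- Points of `Q` are only limits of points of `U`, so `ε` is doubled when passing to `U`.
  have hQU : Q ⊆ closure U := by
    rw [hQ.closure_interior_eq_closure_of_nonempty_interior hint]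
    exact subset_closure
  have hnear : ∀ ε : ℝ, 0 < ε → ∀ x ∈ Q + ε • Metric.closedBall (0 : E) 1,
      ∃ u ∈ U, ‖x - u‖ ≤ 2 * ε := by
    intro ε hε x hx
    obtain ⟨q, hq, hxq⟩ := exists_norm_sub_le_of_mem_add_smul hε hx
    obtain ⟨u, hu, hqu⟩ := Metric.mem_closure_iff.1 (hQU hq) ε hε
    rw [dist_eq_norm] at hqu
    refine ⟨u, hu, ?_⟩
    calc ‖x - u‖ = ‖(x - q) + (q - u)‖ := by congr 1; abel
      _ ≤ ‖x - q‖ + ‖q - u‖ := norm_add_le _ _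
      _ ≤ _ := by linarith
  by_cases hU0 : μ U = 0
  · have hdisj : Disjoint U μ.support :=
      Set.subset_compl_iff_disjoint_right.1 (Measure.subset_compl_support_of_isOpen hUo hU0)
    obtain ⟨f, s, hfU, hfS⟩ := geometric_hahn_banach_open hUc hUo hμ.convex_support hdisj
    obtain ⟨y, hy⟩ := Measure.nonempty_support (IsProbabilityMeasure.ne_zero μ)
    obtain ⟨u₀, hu₀⟩ := hint
    have hf0 : f ≠ 0 := by
      rintro rfl
      have h1 := hfU u₀ hu₀
      have h2 := hfS y hy
      simp only [zero_apply] at h1 h2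
      linarith
    obtain ⟨θ, hθ, c, hc, hfθ⟩ := exists_unit_inner_eq hf0
    filter_upwards [self_mem_nhdsWithin] with ε hε
    rw [Set.mem_Ioi] at hε
    have h1 := hslab θ hθ (s / c) (2 * ε) (by positivity)
    have h2 : μ.real ((Q + ε • Metric.closedBall (0 : E) 1) \ Q) ≤ D * (2 * ε) := by
      refine le_trans ?_ h1
      -- Up to a null set only support points count: they lie beyond the separating hyperplane, and
      -- within `2 ε` of `U` on the other side.
      refine ENNReal.toReal_mono (measure_ne_top _ _) (measure_mono_ae ?_)
      filter_upwards [Measure.support_mem_ae (μ := μ)] with x hxS hx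
      obtain ⟨u, hu, hxu⟩ := hnear ε hε x hx.1
      have h3 := (abs_le.1 (inner_le_add_of_norm_sub_le hθ hxu)).2
      have h4 := hfU u hu
      have h5 := hfS x hxS
      rw [hfθ] at h4 h5
      refine ⟨(div_le_iff₀' hc).2 h5, ?_⟩
      have := (lt_div_iff₀' hc).2 h4
      linarith
    have h3 := mul_le_mul_of_nonneg_right hcoef hε.le
    nlinarith [mul_nonneg hD hε.le]
  by_cases hUne : U = Set.univ
  · have hQuniv : Q = Set.univ := Set.eq_univ_of_univ_subset (hUne ▸ interior_subset)
    filter_upwards [self_mem_nhdsWithin] with ε hε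
    rw [Set.mem_Ioi] at hε
    rw [hQuniv, Set.sdiff_univ, measureReal_empty]
    positivity
  obtain ⟨r, hr, hball, hUr⟩ := exists_closedBall_subset_of_slab_le hL2 hslab hUo hUc hUne hU0
  have : IsProbabilityMeasure (ProbabilityTheory.cond μ U) :=
    ProbabilityTheory.cond_isProbabilityMeasure hU0
  have hL2' : MemLp id 2 (ProbabilityTheory.cond μ U) :=
    (hL2.restrict U).smul_measure (ENNReal.inv_ne_top.2 hU0)
  have hhalf := (hμ.cond hUo.measurableSet hUc hU0).le_half_dilate hL2'
    (ProbabilityTheory.ae_cond_mem hUo.measurableSet) hUo hUc hn hfr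
  set b := ∫ y, y ∂(ProbabilityTheory.cond μ U)
  have hUpos : 0 < μ.real U := ENNReal.toReal_pos hU0 (measure_ne_top _ _)
  set K : ℝ := 2 * (2 * (313600 * n ^ 2 : ℕ) + 1 : ℝ) ^ n
  have hK : 1 ≤ K := by
    have : (1 : ℝ) ≤ (2 * (313600 * n ^ 2 : ℕ) + 1 : ℝ) ^ n := one_le_pow₀ (by
      have : (0 : ℝ) ≤ (313600 * n ^ 2 : ℕ) := Nat.cast_nonneg _
      linarith)
    simp only [K]; linarith
  set H := Real.log K
  have hH0 : 0 ≤ H := Real.log_nonneg hK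
  have hHn : H ≤ 627204 * (n : ℝ) ^ 2 := log_two_mul_pow_le hn
  have hhalf' : μ.real U * Real.exp (-H) ≤ μ.real {z | b + (2 : ℝ) • (z - b) ∈ U} := by
    rw [Real.exp_neg, Real.exp_log (by linarith), ← one_div]
    rw [measureReal_cond_apply hUo.measurableSet, inv_mul_eq_div,
      le_div_iff₀ hUpos] at hhalf
    rw [mul_comm]
    exact hhalf.trans (measureReal_mono Set.inter_subset_right)
  have hsmall : ∀ᶠ ε : ℝ in 𝓝[>] 0, 2 * (2 * ε / r) * H ≤ 1 := by
    have hc : ContinuousAt (fun ε : ℝ => 2 * (2 * ε / r) * H) 0 := by fun_prop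
    have : ∀ᶠ ε : ℝ in 𝓝 0, 2 * (2 * ε / r) * H < 1 :=
      hc.eventually_lt_const (by simp)
    exact (this.filter_mono nhdsWithin_le_nhds).mono fun ε h => h.le
  filter_upwards [self_mem_nhdsWithin, hsmall] with ε hε hεH
  rw [Set.mem_Ioi] at hε
  have h1 := hμ.measureReal_diff_le hUo hUc hr hball hH0 hUpos hhalf' (ε := 2 * ε) (by positivity)
    hεH (hnear ε hε)
  calc μ.real ((Q + ε • Metric.closedBall (0 : E) 1) \ Q)
      ≤ μ.real ((Q + ε • Metric.closedBall (0 : E) 1) \ U) :=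
        measureReal_mono (Set.sdiff_subset_sdiff_right interior_subset)
    _ ≤ 4 * H * μ.real U / r * (2 * ε) := h1
    _ = 8 * H * (μ.real U / r) * ε := by ring
    _ ≤ 8 * (627204 * (n : ℝ) ^ 2) * (36 * D) * ε := by
        gcongr
        exact (div_le_iff₀ hr).2 hUr
    _ = _ := by ring

end Perimeter

/-! ### Isotropic measures and the final bound -/

theorem IsIsotropicMeasure.one_le_integral_sq_sub {n : ℕ}
    {μ : Measure (EuclideanSpace ℝ (Fin n))} (h : IsIsotropicMeasure μ)
    {θ : EuclideanSpace ℝ (Fin n)} (hθ : ‖θ‖ = 1) (a : ℝ) :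
    1 ≤ ∫ x, (inner ℝ θ x - a) ^ 2 ∂μ := by
  have := h.isProbabilityMeasure
  have hL2 : MemLp (fun x => inner ℝ θ x) 2 μ := h.memLp_two.const_inner θ
  have hI := hL2.integrable (by norm_num)
  have h0 : ∫ x, inner ℝ θ x ∂μ = 0 := by
    rw [integral_inner (h.memLp_two.integrable (by norm_num)), h.barycenter_eq_zero,
      inner_zero_right]
  have h1 : ∫ x, (inner ℝ θ x) ^ 2 ∂μ = 1 := by
    rw [← h.integral_inner_sq θ hθ]
    simp only [real_inner_comm]
  have e : ∀ x, (inner ℝ θ x - a) ^ 2 = (inner ℝ θ x) ^ 2 - 2 * a * inner ℝ θ x + a ^ 2 :=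
    fun x => by ring
  simp only [e]
  rw [integral_add (show Integrable (fun x => (inner ℝ θ x) ^ 2 - 2 * a * inner ℝ θ x) μ from
      hL2.integrable_sq.sub (hI.const_mul _)) (integrable_const _),
    integral_sub hL2.integrable_sq (hI.const_mul _), integral_const_mul, h0, h1]
  simp only [mul_zero, sub_zero, integral_const, probReal_univ, smul_eq_mul, one_mul]
  nlinarith [sq_nonneg a]

theorem IsIsotropicMeasure.maxPerimeter_le {n : ℕ} {μ : Measure (EuclideanSpace ℝ (Fin n))}
    (hiso : IsIsotropicMeasure μ) (hμ : IsLogConcaveMeasure μ) :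
    maxPerimeter μ ≤ ENNReal.ofReal (288 * 627204 * 60 * (n : ℝ) ^ 2) := by
  have := hiso.isProbabilityMeasure
  refine iSup₂_le fun Q hQ => ?_
  refine liminf_le_of_frequently_le' (Eventually.frequently ?_)
  -- In dimension zero a nonempty set is the whole space, so nothing is added.
  rcases Nat.eq_zero_or_pos n with rfl | hn
  · refine Eventually.of_forall fun ε => ?_
    have : (Q + ε • Metric.closedBall (0 : EuclideanSpace ℝ (Fin 0)) 1) \ Q = ∅ := by
      rcases Set.eq_empty_or_nonempty Q with rfl | ⟨q, hq⟩
      · simp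
      · ext x
        simp [Subsingleton.elim x q, hq]
    simp [this]
  · have hev := hμ.logConcave.eventually_measureReal_diff_le hiso.memLp_two hn
      (by simp) (D := 60) (by norm_num)
      (fun θ hθ a w hw => hμ.logConcave.slab_le θ (hiso.one_le_integral_sq_sub hθ) a hw) hQ
    filter_upwards [hev, self_mem_nhdsWithin] with ε hε hε0
    rw [Set.mem_Ioi] at hε0
    rw [← ofReal_measureReal, ← ENNReal.ofReal_div_of_pos hε0]
    exact ENNReal.ofReal_le_ofReal ((div_le_iff₀ hε0).2 hε)

theorem mainTheorem3 :
    ∃ C : ℝ, 0 < C ∧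
      ∀ (n : ℕ) (Ω : Type*) [MeasurableSpace Ω] (P : Measure Ω) [IsProbabilityMeasure P]
        (X : Ω → EuclideanSpace ℝ (Fin n)), AEMeasurable X P →
        IsLogConcaveMeasure (P.map X) → IsIsotropicMeasure (P.map X) →
        maxPerimeter (P.map X) ≤ ENNReal.ofReal (C * (n : ℝ) ^ 2) :=
  ⟨288 * 627204 * 60, by norm_num, fun _ _ _ _ _ _ _ hμ hiso => hiso.maxPerimeter_le hμ⟩
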